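/- Let $n\ge 1$, let $\Omega\subseteq\mathbb{R}^n$ be a non-empty open set, and write $L^2=L^2_{\mathbb C}(\Omega)$ (Lebesgue measure), with norm $\|\cdot\|_2$, and $(L^2)^n$ with norm $\|q\|_{2,n}=(\sum_{j}\|q_j\|_2^2)^{1/2}$. For $1\le j\le n$ let $\partial^{e_j}$ be the weak partial derivative, that is, $-1$ times the adjoint of the operator $C_0^\infty(\Omega,\mathbb C)\to L^2$, $\varphi\mapsto\partial\varphi/\partial x_j$, in $L^2$. Let $W^1=\bigcap_j D(\partial^{e_j})$, let $\nabla_w u=(\partial^{e_1}u,\dots,\partial^{e_n}u)$ for $u\in W^1$, and let $W^1_0$ be the closure of $C_0^\infty(\Omega,\mathbb C)$ in $W^1$ with respect to the norm $(\|u\|_2^2+\|\nabla_w u\|_{2,n}^2)^{1/2}$. Let $\nabla_0^*$ be the adjoint of $\nabla_0: C_0^\infty(\Omega,\mathbb C)\to (L^2)^n$, $\varphi\mapsto(\partial\varphi/\partial x_1,\dots,\partial\varphi/\partial x_n)$. Assume that there are $j\in\{1,\dots,n\}$ and $c>0$ with $$\|\partial^{e_j}f\|_2\ \ge\ c\,\|f\|_2\qquad\text{for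 all } f\in W^1_0 .$$ Let $\mathcal L$ be the set of (a.e. classes of) real-valued measurable functions $\bar p$ on $\Omega$ for which there are real $C_2\ge C_1>0$ with $C_1\le\bar p\le C_2$ a.e. on $\Omega$. For $\bar p\in\mathcal L$ let $A$ be the operator in $L^2$ with $$D(A)=\{u\in W^1_0:\ (1/\bar p)\nabla_w u\in D(\nabla_0^*)\},\qquad Au=\nabla_0^*\,(1/\bar p)\,\nabla_w u .$$ Let $\bar p_1,\bar p_2,\dots$ be a uniformly bounded sequence in $\mathcal L$ for which there is $\varepsilon>0$ with $\bar p_\nu\ge\varepsilon$ a.e. on $\Omega$ for all $\nu$, and which converges a.e. pointwise on $\Omega$ to some $\bar p_\infty\in\mathcal L$. Let $A_\nu$ and $A_\infty$ be the operators $A$ associated with $\bar p_\nu$ and $\bar p_\infty$, and let $p_\nu=1/\bar p_\nu$, $p_\infty=1/\bar p_\infty$. Then $A_\nu: D(A_\nu)\to L^2$ (for every $\nu$) and $A_\infty: D(A_\infty)\to L^2$ are bijective, and for every $f\in L^2$ $$\lim_{\nu\to\infty}\|A_\nu^{-1}f-A_\infty^{-1}f\|_2=0\qquad\text{and}\qquad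 \lim_{\nu\to\infty}\|p_\nu\nabla_wA_\nu^{-1}f-p_\infty\nabla_wA_\infty^{-1}f\|_{2,n}=0 .$$ -/

import Mathlib

open MeasureTheory TopologicalSpace Filter
open scoped ENNReal Topology Distributions LinearPMap

noncomputable section

namespace Diffusion

variable {n : ℕ}

/-- The complex Hilbert space `L²(Ω)` with respect to Lebesgue measure on `Ω ⊆ ℝⁿ`. -/
abbrev L2 (Ω : Opens (EuclideanSpace ℝ (Fin n))) : Type :=
  Lp ℂ 2 (volume.restrict (Ω : Set (EuclideanSpace ℝ (Fin n))))

/-- The Hilbert space `(L²(Ω))ⁿ` with `‖q‖² = ∑ⱼ ‖qⱼ‖²`. -/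
abbrev L2Vec (Ω : Opens (EuclideanSpace ℝ (Fin n))) : Type :=
  PiLp 2 (fun _ : Fin n => L2 Ω)

/-- The composition `g ∘ f` of partially defined operators on its natural domain
`{x ∈ D(f) | f x ∈ D(g)}`. -/
def pcomp {E F G : Type*} [AddCommGroup E] [Module ℂ E] [AddCommGroup F] [Module ℂ F]
    [AddCommGroup G] [Module ℂ G] (g : F →ₗ.[ℂ] G) (f : E →ₗ.[ℂ] F) : E →ₗ.[ℂ] G where
  domain := (g.domain.comap f.toFun).map f.domain.subtype
  toFun := g.toFun ∘ₗ f.toFun.submoduleComap g.domain ∘ₗ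
    (Submodule.equivSubtypeMap f.domain (g.domain.comap f.toFun)).symm.toLinearMap

theorem mem_pcomp_domain {E F G : Type*} [AddCommGroup E] [Module ℂ E] [AddCommGroup F]
    [Module ℂ F] [AddCommGroup G] [Module ℂ G] (g : F →ₗ.[ℂ] G) (f : E →ₗ.[ℂ] F) (x : E) :
    x ∈ (pcomp g f).domain ↔ ∃ hx : x ∈ f.domain, f ⟨x, hx⟩ ∈ g.domain := by
  simp only [pcomp, Submodule.mem_map, Submodule.mem_comap, Subtype.exists]
  constructor
  · rintro ⟨y, hy, h, rfl⟩
    exact ⟨hy, h⟩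
  · rintro ⟨hx, h⟩
    exact ⟨x, hx, h, rfl⟩

theorem pcomp_apply {E F G : Type*} [AddCommGroup E] [Module ℂ E] [AddCommGroup F]
    [Module ℂ F] [AddCommGroup G] [Module ℂ G] (g : F →ₗ.[ℂ] G) (f : E →ₗ.[ℂ] F) (x : E)
    (hx : x ∈ f.domain) (h : f ⟨x, hx⟩ ∈ g.domain) (hx' : x ∈ (pcomp g f).domain) :
    pcomp g f ⟨x, hx'⟩ = g ⟨f ⟨x, hx⟩, h⟩ := by
  have : (Submodule.equivSubtypeMap f.domain (g.domain.comap f.toFun)).symm ⟨x, hx'⟩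
      = ⟨⟨x, hx⟩, h⟩ := by
    rw [LinearEquiv.symm_apply_eq]
    rfl
  change g.toFun (f.toFun.submoduleComap g.domain
    ((Submodule.equivSubtypeMap f.domain (g.domain.comap f.toFun)).symm ⟨x, hx'⟩)) = _
  rw [this]
  rfl

section TestFunctions

variable (Ω : Opens (EuclideanSpace ℝ (Fin n)))

theorem memLp_testFunction (φ : 𝓓(Ω, ℂ)) :
    MemLp φ 2 (volume.restrict (Ω : Set (EuclideanSpace ℝ (Fin n)))) :=
  φ.continuous.memLp_of_hasCompactSupport φ.hasCompactSupport

/-- The inclusion of `C₀^∞(Ω, ℂ)` into `L²(Ω)`. -/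
def testToL2 : 𝓓(Ω, ℂ) →ₗ[ℂ] L2 Ω where
  toFun φ := (memLp_testFunction Ω φ).toLp φ
  map_add' _ _ := rfl
  map_smul' _ _ := rfl

theorem testToL2_injective : Function.Injective (testToL2 Ω) := by
  intro φ ψ h
  have h1 : (φ : EuclideanSpace ℝ (Fin n) → ℂ)
      =ᵐ[volume.restrict (Ω : Set (EuclideanSpace ℝ (Fin n)))] ψ :=
    (MemLp.toLp_eq_toLp_iff (memLp_testFunction Ω φ) (memLp_testFunction Ω ψ)).1 h
  have h2 := Measure.eqOn_open_of_ae_eq h1 Ω.isOpen φ.continuous.continuousOn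
    ψ.continuous.continuousOn
  ext x
  by_cases hx : x ∈ (Ω : Set (EuclideanSpace ℝ (Fin n)))
  · exact h2 hx
  · rw [image_eq_zero_of_notMem_tsupport fun hx' => hx (φ.tsupport_subset hx'),
      image_eq_zero_of_notMem_tsupport fun hx' => hx (ψ.tsupport_subset hx')]

/-- `C₀^∞(Ω, ℂ)` as a subspace of `L²(Ω)`. -/
abbrev testSubmodule : Submodule ℂ (L2 Ω) := LinearMap.range (testToL2 Ω)

/-- The test function represented by an element of `testSubmodule Ω`. -/
def toTest : testSubmodule Ω ≃ₗ[ℂ] 𝓓(Ω, ℂ) :=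
  (LinearEquiv.ofInjective (testToL2 Ω) (testToL2_injective Ω)).symm

theorem toTest_testToL2 (φ : 𝓓(Ω, ℂ)) : toTest Ω ⟨testToL2 Ω φ, φ, rfl⟩ = φ := by
  rw [toTest, LinearEquiv.symm_apply_eq]
  rfl

/-- The classical partial derivative `φ ↦ ∂φ/∂xⱼ ∈ L²(Ω)` on `C₀^∞(Ω, ℂ)`. -/
def testPartial (j : Fin n) : 𝓓(Ω, ℂ) →ₗ[ℂ] L2 Ω :=
  testToL2 Ω ∘ₗ
    (TestFunction.lineDerivCLM ℂ (EuclideanSpace.single j (1 : ℝ)) :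
      𝓓(Ω, ℂ) →L[ℂ] 𝓓(Ω, ℂ)).toLinearMap

/-- The operator `C₀^∞(Ω, ℂ) → L²(Ω), φ ↦ ∂φ/∂xⱼ` in `L²(Ω)`. -/
def partialZero (j : Fin n) : L2 Ω →ₗ.[ℂ] L2 Ω where
  domain := testSubmodule Ω
  toFun := testPartial Ω j ∘ₗ (toTest Ω).toLinearMap

/-- The operator `∇₀ : C₀^∞(Ω, ℂ) → (L²(Ω))ⁿ` in `L²(Ω)`. -/
def gradZero : L2 Ω →ₗ.[ℂ] L2Vec Ω where
  domain := testSubmodule Ω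
  toFun := (WithLp.linearEquiv 2 ℂ (Fin n → L2 Ω)).symm.toLinearMap ∘ₗ
    LinearMap.pi (fun j => testPartial Ω j) ∘ₗ (toTest Ω).toLinearMap

/-- The domains of `partialZero` and `gradZero` are dense, so that their adjoints are genuine. -/
theorem dense_testSubmodule : Dense (testSubmodule Ω : Set (L2 Ω)) := by
  rw [Submodule.dense_iff_topologicalClosure_eq_top, Submodule.topologicalClosure_eq_top_iff,
    Submodule.eq_bot_iff]
  intro f hf
  rw [Submodule.mem_orthogonal] at hf
  have hloc : LocallyIntegrableOn f (Ω : Set (EuclideanSpace ℝ (Fin n))) := by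
    have := (Lp.memLp f).locallyIntegrable (by norm_num)
    intro x hx
    obtain ⟨s, hs, h⟩ := this x
    refine ⟨s ∩ Ω, inter_mem (mem_nhdsWithin_of_mem_nhds hs) self_mem_nhdsWithin, ?_⟩
    rw [IntegrableOn, Measure.restrict_restrict' Ω.isOpen.measurableSet] at h
    exact h
  have := Ω.isOpen.ae_eq_zero_of_integral_contDiff_smul_eq_zero hloc (fun g hg hc hs => by
    let φ : 𝓓(Ω, ℂ) := ⟨fun x => (g x : ℂ), Complex.ofRealCLM.contDiff.comp hg,
      hc.comp_left (g := fun x : ℝ => (x : ℂ)) (by simp),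
      (closure_mono (by intro x; simp)).trans hs⟩
    have h := hf (testToL2 Ω φ) ⟨φ, rfl⟩
    rw [L2.inner_def] at h
    have h2 : ∫ x in (Ω : Set (EuclideanSpace ℝ (Fin n))), g x • f x = 0 := by
      rw [← h]
      apply integral_congr_ae
      filter_upwards [(memLp_testFunction Ω φ).coeFn_toLp] with x hx
      change _ = inner ℂ ((memLp_testFunction Ω φ).toLp φ x) (f x)
      rw [hx]
      change _ = inner ℂ (g x : ℂ) (f x)
      simp [mul_comm]
    rwa [setIntegral_eq_integral_of_forall_compl_eq_zero] at h2
    intro x hx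
    rw [image_eq_zero_of_notMem_tsupport fun hx' => hx (hs hx'), zero_smul])
  rw [Lp.eq_zero_iff_ae_eq_zero]
  rw [← ae_restrict_iff' Ω.isOpen.measurableSet] at this
  exact this

end TestFunctions

section Sobolev

variable (Ω : Opens (EuclideanSpace ℝ (Fin n)))

/-- The `j`-th weak partial derivative: minus the adjoint of the classical partial derivative on
`C₀^∞(Ω, ℂ)`. -/
def weakPartial (j : Fin n) : L2 Ω →ₗ.[ℂ] L2 Ω := -(partialZero Ω j)†

/-- The Sobolev space `W¹(Ω)`. -/
def W1 : Submodule ℂ (L2 Ω) := ⨅ j : Fin n, (weakPartial Ω j).domain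

/-- The weak gradient `∇_w : W¹(Ω) → (L²(Ω))ⁿ`. -/
def weakGrad : L2 Ω →ₗ.[ℂ] L2Vec Ω where
  domain := W1 Ω
  toFun := (WithLp.linearEquiv 2 ℂ (Fin n → L2 Ω)).symm.toLinearMap ∘ₗ
    LinearMap.pi (fun j => (weakPartial Ω j).toFun ∘ₗ
      Submodule.inclusion (iInf_le (fun j : Fin n => (weakPartial Ω j).domain) j))

/-- The map `u ↦ (u, ∇_w u)` on `W¹(Ω)`. The norm of the image is the Sobolev norm
`(‖u‖² + ∑ⱼ ‖∂ⱼ u‖²)^(1/2)`. -/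
def sobolevEmbedding : W1 Ω →ₗ[ℂ] WithLp 2 (L2 Ω × L2Vec Ω) :=
  (WithLp.linearEquiv 2 ℂ (L2 Ω × L2Vec Ω)).symm.toLinearMap ∘ₗ
    (W1 Ω).subtype.prod (weakGrad Ω).toFun

/-- `W¹₀(Ω)`, the closure of `C₀^∞(Ω, ℂ)` in `W¹(Ω)` with respect to the Sobolev norm. -/
def W10 : Submodule ℂ (L2 Ω) :=
  (((((testSubmodule Ω).comap (W1 Ω).subtype).map (sobolevEmbedding Ω)).topologicalClosure).comap
    (sobolevEmbedding Ω)).map (W1 Ω).subtype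

theorem W10_le_W1 : W10 Ω ≤ W1 Ω := Submodule.map_subtype_le _ _

/-- The restriction of `∇_w` to `W¹₀(Ω)`. -/
def weakGradW10 : L2 Ω →ₗ.[ℂ] L2Vec Ω where
  domain := W10 Ω
  toFun := (weakGrad Ω).toFun ∘ₗ Submodule.inclusion (W10_le_W1 Ω)

/-- The Poincaré inequality `‖∂ⱼ f‖ ≥ c ‖f‖` on `W¹₀(Ω)`, for some `j` and some `c > 0`. -/
def PoincareInequality : Prop :=
  ∃ j : Fin n, ∃ c : ℝ, 0 < c ∧
    ∀ f : (weakGradW10 Ω).domain, c * ‖(f : L2 Ω)‖ ≤ ‖weakGradW10 Ω f j‖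

end Sobolev

section DiffusionOperator

variable (Ω : Opens (EuclideanSpace ℝ (Fin n)))

theorem mulVec_ae_zero (m : EuclideanSpace ℝ (Fin n) → ℝ) :
    (fun x => (m x : ℂ) * (0 : L2 Ω) x)
      =ᵐ[volume.restrict (Ω : Set (EuclideanSpace ℝ (Fin n)))] (0 : EuclideanSpace ℝ (Fin n) → ℂ) := by
  filter_upwards [Lp.coeFn_zero ℂ 2
    (volume.restrict (Ω : Set (EuclideanSpace ℝ (Fin n))))] with x hx
  rw [hx, Pi.zero_apply, mul_zero]

theorem mulVec_ae_add (m : EuclideanSpace ℝ (Fin n) → ℝ) (g h : L2 Ω) :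
    (fun x => (m x : ℂ) * (g + h : L2 Ω) x)
      =ᵐ[volume.restrict (Ω : Set (EuclideanSpace ℝ (Fin n)))]
        ((fun x => (m x : ℂ) * g x) + fun x => (m x : ℂ) * h x) := by
  filter_upwards [Lp.coeFn_add g h] with x hx
  rw [hx, Pi.add_apply, Pi.add_apply, mul_add]

theorem mulVec_ae_smul (m : EuclideanSpace ℝ (Fin n) → ℝ) (c : ℂ) (g : L2 Ω) :
    (fun x => (m x : ℂ) * (c • g : L2 Ω) x)
      =ᵐ[volume.restrict (Ω : Set (EuclideanSpace ℝ (Fin n)))]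
        (c • fun x => (m x : ℂ) * g x) := by
  filter_upwards [Lp.coeFn_smul c g] with x hx
  rw [hx, Pi.smul_apply, Pi.smul_apply, smul_eq_mul, smul_eq_mul, mul_left_comm]

/-- The maximal operator of componentwise multiplication by the real function `m` in `(L²(Ω))ⁿ`.
Its domain consists of the `g` with `m gⱼ ∈ L²(Ω)` for all `j`. -/
def mulVec (m : EuclideanSpace ℝ (Fin n) → ℝ) : L2Vec Ω →ₗ.[ℂ] L2Vec Ω where
  domain :=
    { carrier := {g | ∀ j, MemLp (fun x => (m x : ℂ) * g j x) 2
        (volume.restrict (Ω : Set (EuclideanSpace ℝ (Fin n))))}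
      zero_mem' := fun _ => (memLp_congr_ae (mulVec_ae_zero Ω m)).2 MemLp.zero
      add_mem' := fun {g h} hg hh j =>
        (memLp_congr_ae (mulVec_ae_add Ω m (g j) (h j))).2 ((hg j).add (hh j))
      smul_mem' := fun c g hg j =>
        (memLp_congr_ae (mulVec_ae_smul Ω m c (g j))).2 ((hg j).const_smul c) }
  toFun :=
    { toFun := fun g => WithLp.toLp 2 fun j => (g.2 j).toLp _
      map_add' := fun g h => PiLp.ext fun j =>
        (MemLp.toLp_eq_toLp_iff ((g + h).2 j) ((g.2 j).add (h.2 j))).2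
          (mulVec_ae_add Ω m (g.1 j) (h.1 j))
      map_smul' := fun c g => PiLp.ext fun j =>
        (MemLp.toLp_eq_toLp_iff ((c • g).2 j) ((g.2 j).const_smul c)).2
          (mulVec_ae_smul Ω m c (g.1 j)) }

/-- The operator `u ↦ (1/p̄) ∇_w u` on those `u ∈ W¹₀(Ω)` with `(1/p̄) ∇_w u ∈ (L²(Ω))ⁿ`. -/
def fluxOp (pbar : EuclideanSpace ℝ (Fin n) → ℝ) : L2 Ω →ₗ.[ℂ] L2Vec Ω :=
  pcomp (mulVec Ω (fun x => 1 / pbar x)) (weakGradW10 Ω)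

/-- The diffusion operator `A u = ∇₀* (1/p̄) ∇_w u` with domain
`D(A) = {u ∈ W¹₀(Ω) | (1/p̄) ∇_w u ∈ D(∇₀*)}`. -/
def diffusionOp (pbar : EuclideanSpace ℝ (Fin n) → ℝ) : L2 Ω →ₗ.[ℂ] L2 Ω :=
  pcomp (gradZero Ω)† (fluxOp Ω pbar)

/-- The class `𝓛` of real functions that are measurable on `Ω` and a.e. bounded from below and
above by positive constants. -/
def DiffusivityClass : Set (EuclideanSpace ℝ (Fin n) → ℝ) :=
  {pbar | AEMeasurable pbar (volume.restrict (Ω : Set (EuclideanSpace ℝ (Fin n)))) ∧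
    ∃ C₁ C₂ : ℝ, 0 < C₁ ∧ C₁ ≤ C₂ ∧
      ∀ᵐ x ∂(volume.restrict (Ω : Set (EuclideanSpace ℝ (Fin n)))),
        C₁ ≤ pbar x ∧ pbar x ≤ C₂}

variable {Ω}

/-- `A⁻¹ f ∈ D(A)` for bijective `A : D(A) → L²(Ω)`. -/
def solution {pbar : EuclideanSpace ℝ (Fin n) → ℝ}
    (hA : Function.Bijective (diffusionOp Ω pbar).toFun) (f : L2 Ω) :
    (diffusionOp Ω pbar).domain :=
  (LinearEquiv.ofBijective (diffusionOp Ω pbar).toFun hA).symm f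

/-- `(1/p̄) ∇_w u` for `u ∈ D(A)`. -/
def flux {pbar : EuclideanSpace ℝ (Fin n) → ℝ} (u : (diffusionOp Ω pbar).domain) : L2Vec Ω :=
  fluxOp Ω pbar ⟨u, Submodule.map_subtype_le _ _ u.2⟩

end DiffusionOperator

end Diffusion

end

open Diffusion

/-!
The operator `T = ∇_w` on `W¹₀(Ω)` is the closure of `∇₀` (`graph_weakGradW10`): the Sobolev norm is
the graph norm of the closed operator `∇_w`, and `∇_w` extends `∇₀` by integration by parts. Hence
`∇₀* = T*` (`adjoint_gradZero`), and `A u = f` is the variational equation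
`⟪p T u, T v⟫ = ⟪f, v⟫` for all `v ∈ W¹₀(Ω)` with `p = 1 / p̄` (`diffusionOp_eq_iff`).

By the Poincaré inequality `T` is bounded from below, so its range is a closed subspace of
`(L²(Ω))ⁿ`. The compression to this range of the multiplication by `p` is bounded and coercive, and
`f` defines a bounded functional on the range. The equation is therefore uniquely solvable for
`T u`, which gives the bijectivity of `A` (`exists_weakSolution`, `weakSolution_unique`).

For the convergence let `u_ν` and `u` be the solutions for `p_ν` and `p`. Testing the difference of
the two equations with `u_ν - u` gives `δ ‖T (u_ν - u)‖ ≤ ‖(p - p_ν) T u‖`, where `δ` is a common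
lower bound of the `p_ν` (`norm_sub_le_of_weakSolution`). As `T u` is fixed, the right-hand side
tends to zero by dominated convergence (`tendsto_mulCLM`). The Poincaré inequality then gives
`u_ν → u`, and `p_ν T u_ν - p T u = p_ν T (u_ν - u) - (p - p_ν) T u` gives the convergence of the
fluxes.
-/

noncomputable section

namespace Diffusion

/-! ### Operators of the form `T† M T` in Hilbert spaces -/

section Abstract

variable {E F : Type*} [NormedAddCommGroup E] [InnerProductSpace ℂ E]
  [NormedAddCommGroup F] [InnerProductSpace ℂ F]

/-- The adjoint does not change under passage to the closure of the graph. -/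
theorem adjoint_eq_of_closure_graph [CompleteSpace E] {S T : E →ₗ.[ℂ] F}
    (hS : Dense (S.domain : Set E)) (hST : (T.graph : Set (E × F)) = closure S.graph) :
    S† = T† := by
  have hsub : (S.graph : Set (E × F)) ⊆ T.graph := hST ▸ subset_closure
  have hT : Dense (T.domain : Set E) :=
    hS.mono (LinearPMap.le_of_le_graph (f := S) (g := T) hsub).1
  refine LinearPMap.eq_of_eq_graph ?_
  rw [LinearPMap.adjoint_graph_eq_graph_adjoint hS, LinearPMap.adjoint_graph_eq_graph_adjoint hT]
  ext x
  simp only [Submodule.mem_adjoint_iff]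
  refine ⟨fun h a b hab => ?_, fun h a b hab => h a b (hsub hab)⟩
  have hcl : IsClosed {z : E × F | inner ℂ z.2 x.1 - inner ℂ z.1 x.2 = 0} :=
    isClosed_eq (by fun_prop) continuous_const
  have hab' : (a, b) ∈ closure (S.graph : Set (E × F)) := hST ▸ hab
  exact hcl.closure_subset_iff.2 (fun z hz => h z.1 z.2 hz) hab'

/-- `T† G x = f` says that `x` solves the variational problem `⟪G x, T v⟫ = ⟪f, v⟫` for all
`v ∈ D(T)`. -/
theorem pcomp_adjoint_eq_iff [CompleteSpace E] {T G : E →ₗ.[ℂ] F}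
    (hT : Dense (T.domain : Set E)) (x f : E) :
    (∃ hx : x ∈ (pcomp T† G).domain, pcomp T† G ⟨x, hx⟩ = f) ↔
      ∃ hx : x ∈ G.domain, ∀ v : T.domain, inner ℂ (G ⟨x, hx⟩) (T v) = inner ℂ f (v : E) := by
  constructor
  · rintro ⟨hx, rfl⟩
    obtain ⟨hxG, hxT⟩ := (mem_pcomp_domain _ _ _).1 hx
    refine ⟨hxG, fun v => ?_⟩
    rw [pcomp_apply _ _ _ hxG hxT hx]
    exact (LinearPMap.adjoint_isFormalAdjoint hT ⟨_, hxT⟩ v).symm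
  · rintro ⟨hx, h⟩
    have hxT : G ⟨x, hx⟩ ∈ T†.domain :=
      LinearPMap.mem_adjoint_domain_of_exists _ ⟨f, fun v => (h v).symm⟩
    have hx' := (mem_pcomp_domain T† G x).2 ⟨hx, hxT⟩
    refine ⟨hx', ?_⟩
    rw [pcomp_apply _ _ _ hx hxT hx']
    exact LinearPMap.adjoint_apply_eq hT _ fun v => (h v).symm

/-- A closed operator that is bounded from below has closed range. -/
theorem isClosed_range_of_le_norm [CompleteSpace E] [CompleteSpace F] {T : E →ₗ.[ℂ] F}
    (hT : IsClosed (T.graph : Set (E × F)))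
    {c : ℝ} (hc : 0 < c) (hle : ∀ u : T.domain, c * ‖(u : E)‖ ≤ ‖T u‖) :
    IsClosed (LinearMap.range T.toFun : Set F) := by
  have : CompleteSpace T.graph := hT.completeSpace_coe
  -- The range is the image of the complete graph under the second projection, which is antilipschitz.
  let L : T.graph →L[ℂ] F := (ContinuousLinearMap.snd ℂ E F).comp T.graph.subtypeL
  have hL : AntilipschitzWith (Real.toNNReal (max c⁻¹ 1)) L := by
    refine AddMonoidHomClass.antilipschitz_of_bound L fun z => ?_
    rw [Real.coe_toNNReal _ (zero_le_one.trans (le_max_right _ _))]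
    obtain ⟨u, hu1, hu2⟩ := LinearPMap.mem_graph_iff T |>.1 z.2
    have h1 := hle u
    rw [hu1, hu2] at h1
    change max ‖z.1.1‖ ‖z.1.2‖ ≤ _ * ‖z.1.2‖
    refine max_le ?_ ?_
    · calc ‖z.1.1‖ = c⁻¹ * (c * ‖z.1.1‖) := by field_simp
        _ ≤ c⁻¹ * ‖z.1.2‖ := by gcongr
        _ ≤ _ := by gcongr; exact le_max_left _ _
    · exact le_mul_of_one_le_left (norm_nonneg _) (le_max_right _ _)
  convert hL.isClosed_range L.uniformContinuous using 1
  ext y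
  simp only [SetLike.mem_coe, LinearMap.mem_range, Set.mem_range, Subtype.exists, Prod.exists]
  constructor
  · rintro ⟨a, ha, rfl⟩
    exact ⟨a, _, LinearPMap.mem_graph T ⟨a, ha⟩, rfl⟩
  · rintro ⟨a, b, hab, rfl⟩
    obtain ⟨u, hu1, hu2⟩ := LinearPMap.mem_graph_iff T |>.1 hab
    exact ⟨u.1, u.2, hu2⟩

/-- Existence in the Lax–Milgram theorem for the sesquilinear form `⟪M T u, T v⟫` on `D(T)`. It is
solved for `T u` in the Hilbert space `range T`, where the compression of `M` is coercive. -/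
theorem exists_weakSolution [CompleteSpace F] {T : E →ₗ.[ℂ] F}
    (hran : IsClosed (LinearMap.range T.toFun : Set F))
    {c : ℝ} (hc : 0 < c) (hle : ∀ u : T.domain, c * ‖(u : E)‖ ≤ ‖T u‖)
    (M : F →L[ℂ] F) {δ : ℝ} (hδ : 0 < δ)
    (hM : ∀ q, δ * ‖q‖ ^ 2 ≤ RCLike.re (inner ℂ (M q) q)) (f : E) :
    ∃ u : T.domain, ∀ v : T.domain, inner ℂ (M (T u)) (T v) = inner ℂ f (v : E) := by
  set R := LinearMap.range T.toFun with hR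
  have : CompleteSpace R := hran.completeSpace_coe
  have hinj : Function.Injective T.toFun := by
    rw [injective_iff_map_eq_zero]
    intro u hu
    have h := hle u
    rw [show T u = 0 from hu, norm_zero] at h
    exact Subtype.ext (norm_le_zero_iff.1 (by nlinarith [norm_nonneg (u : E)]))
  let e : T.domain ≃ₗ[ℂ] R := LinearEquiv.ofInjective T.toFun hinj
  have he : ∀ u, ((e u : R) : F) = T u := fun u => rfl
  -- the functional `T u ↦ ⟪f, u⟫` on the range
  let ℓ : StrongDual ℂ R := LinearMap.mkContinuous
    ((innerSL ℂ f).toLinearMap ∘ₗ T.domain.subtype ∘ₗ e.symm.toLinearMap) (‖f‖ * c⁻¹) fun r => by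
      have h := hle (e.symm r)
      rw [← he, e.apply_symm_apply] at h
      calc ‖inner ℂ f ((e.symm r : T.domain) : E)‖
          ≤ ‖f‖ * ‖((e.symm r : T.domain) : E)‖ := norm_inner_le_norm _ _
        _ ≤ ‖f‖ * (c⁻¹ * ‖r‖) := by
          gcongr
          rw [le_inv_mul_iff₀ hc]
          exact h
        _ = _ := by ring
  let g : R := (InnerProductSpace.toDual ℂ R).symm ℓ
  let B : R →L[ℂ] R := R.orthogonalProjectionOnto.comp (M.comp R.subtypeL)
  have hB : ∀ r s : R, inner ℂ (B r) s = inner ℂ (M r) (s : F) := fun r s =>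
    R.inner_orthogonalProjectionOnto_eq_of_mem_right s (M r)
  have hunit : IsUnit B := by
    refine ContinuousLinearMap.isUnit_of_forall_le_norm_inner_map B (c := ⟨δ, hδ.le⟩) hδ fun r => ?_
    rw [hB, mul_comm]
    exact (hM r).trans (RCLike.re_le_norm _)
  obtain ⟨r, hr⟩ := (ContinuousLinearMap.isUnit_iff_bijective.1 hunit).2 g
  refine ⟨e.symm r, fun v => ?_⟩
  rw [← he, e.apply_symm_apply, ← he v, ← hB, hr, InnerProductSpace.toDual_symm_apply]
  change inner ℂ f ((e.symm (e v) : T.domain) : E) = _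
  rw [e.symm_apply_apply]

/-- Stability of variational solutions: the distance of `T u` and `T u'` is controlled by the
difference of the two coefficients at the *fixed* element `T u'`. -/
theorem norm_sub_le_of_weakSolution {T : E →ₗ.[ℂ] F} {M M' : F →L[ℂ] F} {δ : ℝ}
    (hM : ∀ q, δ * ‖q‖ ^ 2 ≤ RCLike.re (inner ℂ (M q) q)) {f : E} {u u' : T.domain}
    (hu : ∀ v : T.domain, inner ℂ (M (T u)) (T v) = inner ℂ f (v : E))
    (hu' : ∀ v : T.domain, inner ℂ (M' (T u')) (T v) = inner ℂ f (v : E)) :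
    δ * ‖T u - T u'‖ ≤ ‖(M' - M) (T u')‖ := by
  -- Test the difference of the two equations with `v = u - u'`.
  have key : inner ℂ (M (T u - T u')) (T u - T u')
      = inner ℂ ((M' - M) (T u')) (T u - T u') := by
    rw [← LinearPMap.map_sub, LinearPMap.map_sub T u u', map_sub, _root_.sub_apply,
      inner_sub_left, inner_sub_left, ← LinearPMap.map_sub, hu, hu']
  rcases (norm_nonneg (T u - T u')).eq_or_lt with h0 | h0
  · rw [← h0, mul_zero]
    exact norm_nonneg _
  · refine le_of_mul_le_mul_right ?_ h0
    calc δ * ‖T u - T u'‖ * ‖T u - T u'‖ = δ * ‖T u - T u'‖ ^ 2 := by ring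
      _ ≤ _ := hM _
      _ ≤ ‖inner ℂ ((M' - M) (T u')) (T u - T u')‖ := key ▸ RCLike.re_le_norm _
      _ ≤ _ := norm_inner_le_norm _ _

/-- Variational solutions are unique. -/
theorem weakSolution_unique {T : E →ₗ.[ℂ] F}
    {c : ℝ} (hc : 0 < c) (hle : ∀ u : T.domain, c * ‖(u : E)‖ ≤ ‖T u‖)
    {M : F →L[ℂ] F} {δ : ℝ} (hδ : 0 < δ)
    (hM : ∀ q, δ * ‖q‖ ^ 2 ≤ RCLike.re (inner ℂ (M q) q)) {f : E} {u u' : T.domain}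
    (hu : ∀ v : T.domain, inner ℂ (M (T u)) (T v) = inner ℂ f (v : E))
    (hu' : ∀ v : T.domain, inner ℂ (M (T u')) (T v) = inner ℂ f (v : E)) : u = u' := by
  have h1 := norm_sub_le_of_weakSolution hM hu hu'
  rw [sub_self, _root_.zero_apply, norm_zero, ← LinearPMap.map_sub] at h1
  have h2 := hle (u - u')
  have h3 : ‖((u - u' : T.domain) : E)‖ ≤ 0 := by
    by_contra! h
    nlinarith [mul_pos hc h, mul_pos hδ ((mul_pos hc h).trans_le h2)]
  exact sub_eq_zero.1 (Subtype.ext (norm_le_zero_iff.1 h3))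

end Abstract

/-! ### The gradient on `W¹₀(Ω)` as a closure -/

section Gradient

variable {n : ℕ} (Ω : Opens (EuclideanSpace ℝ (Fin n)))

theorem inner_testToL2 (φ ψ : 𝓓(Ω, ℂ)) :
    inner ℂ (testToL2 Ω φ) (testToL2 Ω ψ) = ∫ x, starRingEnd ℂ (φ x) * ψ x := by
  have h0 : ∀ x, x ∉ (Ω : Set (EuclideanSpace ℝ (Fin n))) → starRingEnd ℂ (φ x) * ψ x = 0 :=
    fun x hx => by
      rw [image_eq_zero_of_notMem_tsupport fun hx' => hx (ψ.tsupport_subset hx'), mul_zero]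
  rw [L2.inner_def, ← setIntegral_eq_integral_of_forall_compl_eq_zero h0]
  apply integral_congr_ae
  filter_upwards [(memLp_testFunction Ω φ).coeFn_toLp, (memLp_testFunction Ω ψ).coeFn_toLp]
    with x hx hx'
  change inner ℂ ((memLp_testFunction Ω φ).toLp φ x) ((memLp_testFunction Ω ψ).toLp ψ x) = _
  rw [hx, hx', RCLike.inner_apply, mul_comm]

/-- Integration by parts for test functions. -/
theorem inner_testPartial (j : Fin n) (φ ψ : 𝓓(Ω, ℂ)) :
    inner ℂ (testPartial Ω j φ) (testToL2 Ω ψ) = -inner ℂ (testToL2 Ω φ) (testPartial Ω j ψ) := by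
  have hd : ∀ (χ : 𝓓(Ω, ℂ)) x, (TestFunction.lineDerivCLM ℂ (EuclideanSpace.single j (1 : ℝ)) χ :
      𝓓(Ω, ℂ)) x = fderiv ℝ χ x (EuclideanSpace.single j (1 : ℝ)) := fun χ x => by
    rw [TestFunction.lineDerivCLM_eq_fderivCLM, TestFunction.fderivCLM_apply, if_pos (by simp)]
  have hint : ∀ χ χ' : 𝓓(Ω, ℂ), Integrable (fun x => starRingEnd ℂ (χ x) * χ' x) := fun χ χ' =>
    ((Complex.continuous_conj.comp χ.continuous).mul χ'.continuous).integrable_of_hasCompactSupport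
      χ'.hasCompactSupport.mul_left
  change inner ℂ (testToL2 Ω (TestFunction.lineDerivCLM ℂ _ φ)) _
    = -inner ℂ _ (testToL2 Ω (TestFunction.lineDerivCLM ℂ _ ψ))
  rw [inner_testToL2, inner_testToL2, eq_neg_iff_add_eq_zero, add_comm, ← eq_neg_iff_add_eq_zero]
  have h1 := hint (TestFunction.lineDerivCLM ℂ (EuclideanSpace.single j (1 : ℝ)) φ) ψ
  have h2 := hint φ (TestFunction.lineDerivCLM ℂ (EuclideanSpace.single j (1 : ℝ)) ψ)
  simp only [hd] at h1 h2 ⊢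
  have hdiff : ∀ (χ : 𝓓(Ω, ℂ)) x, DifferentiableAt ℝ χ x := fun χ x =>
    (χ.contDiff.differentiable (by simp)).differentiableAt
  exact integral_bilinear_fderiv_right_eq_neg_left_of_integrable
    (B := (ContinuousLinearMap.mul ℝ ℂ).comp (Complex.conjCLE : ℂ →L[ℝ] ℂ))
    h1 h2 (hint φ ψ) (fun x _ => hdiff φ x) (fun x _ => hdiff ψ x)

theorem partialZero_apply (j : Fin n) (φ : 𝓓(Ω, ℂ)) :
    partialZero Ω j ⟨testToL2 Ω φ, φ, rfl⟩ = testPartial Ω j φ :=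
  congrArg (testPartial Ω j) (toTest_testToL2 Ω φ)

theorem gradZero_apply (φ : 𝓓(Ω, ℂ)) (j : Fin n) :
    gradZero Ω ⟨testToL2 Ω φ, φ, rfl⟩ j = testPartial Ω j φ :=
  congrArg (testPartial Ω j) (toTest_testToL2 Ω φ)

theorem mem_graph_gradZero_iff (u : L2 Ω) (q : L2Vec Ω) :
    (u, q) ∈ (gradZero Ω).graph ↔ ∃ φ, testToL2 Ω φ = u ∧ ∀ j, testPartial Ω j φ = q j := by
  rw [LinearPMap.mem_graph_iff]
  constructor
  · rintro ⟨⟨_, φ, rfl⟩, rfl, rfl⟩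
    exact ⟨φ, rfl, fun j => (gradZero_apply Ω φ j).symm⟩
  · rintro ⟨φ, rfl, h⟩
    exact ⟨⟨_, φ, rfl⟩, rfl, PiLp.ext fun j => (gradZero_apply Ω φ j).trans (h j)⟩

/-- The weak partial derivatives are characterised by testing against `C₀^∞(Ω, ℂ)`. -/
theorem mem_graph_weakPartial_iff (j : Fin n) (u w : L2 Ω) :
    (u, w) ∈ (weakPartial Ω j).graph ↔
      ∀ φ, inner ℂ w (testToL2 Ω φ) = -inner ℂ u (testPartial Ω j φ) := by
  have hdense : Dense ((partialZero Ω j).domain : Set (L2 Ω)) := dense_testSubmodule Ω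
  rw [LinearPMap.mem_graph_iff]
  constructor
  · rintro ⟨v, rfl, rfl⟩ φ
    have h := LinearPMap.adjoint_isFormalAdjoint hdense ⟨v.1, v.2⟩ ⟨testToL2 Ω φ, φ, rfl⟩
    rw [partialZero_apply] at h
    rw [← h, ← inner_neg_left]
    rfl
  · intro h
    have h' : ∀ v : (partialZero Ω j).domain,
        inner ℂ (-w) (v : L2 Ω) = inner ℂ u (partialZero Ω j v) := by
      rintro ⟨_, φ, rfl⟩
      rw [partialZero_apply, inner_neg_left, h, neg_neg]
    have hu : u ∈ (partialZero Ω j)†.domain :=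
      LinearPMap.mem_adjoint_domain_of_exists _ ⟨-w, h'⟩
    refine ⟨⟨u, hu⟩, rfl, ?_⟩
    change -((partialZero Ω j)† ⟨u, hu⟩) = w
    rw [LinearPMap.adjoint_apply_eq hdense ⟨u, hu⟩ h', neg_neg]

theorem mem_graph_weakGrad_iff (u : L2 Ω) (q : L2Vec Ω) :
    (u, q) ∈ (weakGrad Ω).graph ↔
      ∀ j φ, inner ℂ (q j) (testToL2 Ω φ) = -inner ℂ u (testPartial Ω j φ) := by
  simp_rw [← mem_graph_weakPartial_iff, LinearPMap.mem_graph_iff]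
  constructor
  · rintro ⟨v, rfl, rfl⟩ j
    exact ⟨⟨v, (Submodule.mem_iInf _).1 v.2 j⟩, rfl, rfl⟩
  · intro h
    have hu : u ∈ W1 Ω := (Submodule.mem_iInf _).2 fun j => by
      obtain ⟨v, rfl, -⟩ := h j
      exact v.2
    refine ⟨⟨u, hu⟩, rfl, PiLp.ext fun j => ?_⟩
    obtain ⟨v, hv, hvq⟩ := h j
    rw [← hvq]
    exact congrArg (weakPartial Ω j) (Subtype.ext hv.symm)

theorem isClosed_graph_weakGrad : IsClosed ((weakGrad Ω).graph : Set (L2 Ω × L2Vec Ω)) := by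
  have : ((weakGrad Ω).graph : Set (L2 Ω × L2Vec Ω)) = ⋂ j, ⋂ φ,
      {z | inner ℂ (z.2 j) (testToL2 Ω φ) = -inner ℂ z.1 (testPartial Ω j φ)} := by
    ext ⟨u, q⟩
    simp only [SetLike.mem_coe, mem_graph_weakGrad_iff, Set.mem_iInter, Set.mem_ofPred_eq]
  rw [this]
  exact isClosed_iInter fun j => isClosed_iInter fun φ => isClosed_eq (by fun_prop) (by fun_prop)

theorem gradZero_graph_le : (gradZero Ω).graph ≤ (weakGrad Ω).graph := by
  rintro ⟨u, q⟩ h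
  obtain ⟨φ, rfl, hq⟩ := (mem_graph_gradZero_iff Ω u q).1 h
  refine (mem_graph_weakGrad_iff Ω _ _).2 fun j ψ => ?_
  rw [← hq, inner_testPartial]

/-- `∇_w` on `W¹₀(Ω)` is the closure of `∇₀`: the Sobolev norm on `W¹(Ω)` is the graph norm of the
closed operator `∇_w`, which extends `∇₀`. -/
theorem graph_weakGradW10 :
    ((weakGradW10 Ω).graph : Set (L2 Ω × L2Vec Ω)) = closure (gradZero Ω).graph := by
  have hW : ∀ u q, (u, q) ∈ (weakGradW10 Ω).graph ↔ ∃ v : W1 Ω, (v : L2 Ω) = u ∧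
      weakGrad Ω v = q ∧ sobolevEmbedding Ω v ∈ closure
        ((((testSubmodule Ω).comap (W1 Ω).subtype).map (sobolevEmbedding Ω) :
          Submodule ℂ (WithLp 2 (L2 Ω × L2Vec Ω))) : Set (WithLp 2 (L2 Ω × L2Vec Ω))) := by
    intro u q
    rw [LinearPMap.mem_graph_iff]
    constructor
    · rintro ⟨⟨_, v, hv, rfl⟩, rfl, rfl⟩
      exact ⟨v, rfl, rfl, hv⟩
    · rintro ⟨v, rfl, rfl, hv⟩
      exact ⟨⟨v, v, hv, rfl⟩, rfl, rfl⟩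
  let e := (WithLp.prodContinuousLinearEquiv 2 ℂ (L2 Ω) (L2Vec Ω)).toHomeomorph
  -- On test functions the weak and the classical gradient agree.
  have he : ((((testSubmodule Ω).comap (W1 Ω).subtype).map (sobolevEmbedding Ω) :
      Submodule ℂ (WithLp 2 (L2 Ω × L2Vec Ω))) : Set (WithLp 2 (L2 Ω × L2Vec Ω)))
      = e ⁻¹' (gradZero Ω).graph := by
    ext z
    constructor
    · rintro ⟨v, ⟨φ, hφ⟩, rfl⟩
      refine (mem_graph_gradZero_iff Ω _ _).2 ⟨φ, hφ, fun j => ?_⟩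
      have h1 : (testToL2 Ω φ, WithLp.toLp 2 fun j => testPartial Ω j φ) ∈ (weakGrad Ω).graph :=
        gradZero_graph_le Ω ((mem_graph_gradZero_iff Ω _ _).2 ⟨φ, rfl, fun _ => rfl⟩)
      obtain ⟨v', hv', hq⟩ := (LinearPMap.mem_graph_iff _).1 h1
      have hvv : v = v' := Subtype.ext (hφ.symm.trans hv'.symm)
      change _ = weakGrad Ω v j
      rw [hvv, hq]
    · intro hz
      obtain ⟨v', hv', hq⟩ := (LinearPMap.mem_graph_iff _).1 (gradZero_graph_le Ω hz)
      obtain ⟨φ, hφ, -⟩ := (mem_graph_gradZero_iff Ω _ _).1 hz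
      exact ⟨v', ⟨φ, hφ.trans hv'.symm⟩, e.injective (Prod.ext hv' hq)⟩
  ext ⟨u, q⟩
  rw [SetLike.mem_coe, hW, he, ← e.preimage_closure]
  constructor
  · rintro ⟨v, rfl, rfl, hv⟩
    exact hv
  · intro h
    obtain ⟨v, hv, hq⟩ := (LinearPMap.mem_graph_iff _).1
      ((isClosed_graph_weakGrad Ω).closure_subset_iff.2 (gradZero_graph_le Ω) h)
    refine ⟨v, hv, hq, ?_⟩
    have he' : e (sobolevEmbedding Ω v) = (u, q) := Prod.ext hv hq
    rwa [Set.mem_preimage, he']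

theorem isClosed_graph_weakGradW10 :
    IsClosed ((weakGradW10 Ω).graph : Set (L2 Ω × L2Vec Ω)) :=
  graph_weakGradW10 Ω ▸ isClosed_closure

theorem dense_domain_weakGradW10 : Dense ((weakGradW10 Ω).domain : Set (L2 Ω)) := by
  have hsub : ((gradZero Ω).graph : Set (L2 Ω × L2Vec Ω)) ⊆ (weakGradW10 Ω).graph :=
    graph_weakGradW10 Ω ▸ subset_closure
  exact (dense_testSubmodule Ω).mono
    (LinearPMap.le_of_le_graph (f := gradZero Ω) (g := weakGradW10 Ω) hsub).1

theorem adjoint_gradZero : (gradZero Ω)† = (weakGradW10 Ω)† :=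
  adjoint_eq_of_closure_graph (dense_testSubmodule Ω) (graph_weakGradW10 Ω)

theorem PoincareInequality.exists_le_norm {Ω : Opens (EuclideanSpace ℝ (Fin n))}
    (h : PoincareInequality Ω) :
    ∃ c : ℝ, 0 < c ∧ ∀ u : (weakGradW10 Ω).domain, c * ‖(u : L2 Ω)‖ ≤ ‖weakGradW10 Ω u‖ := by
  obtain ⟨j, c, hc, h⟩ := h
  exact ⟨c, hc, fun u => (h u).trans (PiLp.norm_apply_le _ j)⟩

end Gradient

/-! ### Multiplication operators -/

section Multiplication

variable {n : ℕ} (Ω : Opens (EuclideanSpace ℝ (Fin n)))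
  {m : EuclideanSpace ℝ (Fin n) → ℝ} {C : ℝ}

theorem mulVec_domain_eq_top
    (hm : AEMeasurable m (volume.restrict (Ω : Set (EuclideanSpace ℝ (Fin n)))))
    (hC : ∀ᵐ x ∂(volume.restrict (Ω : Set (EuclideanSpace ℝ (Fin n)))), |m x| ≤ C) :
    (mulVec Ω m).domain = ⊤ := by
  refine eq_top_iff.2 fun g _ j => (Lp.memLp (g j)).of_le_mul (c := C) ?_ ?_
  · exact (Complex.measurable_ofReal.comp_aemeasurable hm).aestronglyMeasurable.mul
      (Lp.aestronglyMeasurable _)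
  · filter_upwards [hC] with x hx
    rw [norm_mul, Complex.norm_real, Real.norm_eq_abs]
    gcongr

theorem mulVec_apply_coeFn (g : (mulVec Ω m).domain) (j : Fin n) :
    mulVec Ω m g j =ᵐ[volume.restrict (Ω : Set (EuclideanSpace ℝ (Fin n)))]
      fun x => (m x : ℂ) * (g : L2Vec Ω) j x :=
  (g.2 j).coeFn_toLp

/-- The norm of `(L²(Ω))ⁿ` is monotone in the components. -/
theorem norm_le_mul_norm_of_forall {q g : L2Vec Ω} (hC : 0 ≤ C) (h : ∀ j, ‖q j‖ ≤ C * ‖g j‖) :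
    ‖q‖ ≤ C * ‖g‖ := by
  refine le_of_sq_le_sq ?_ (by positivity)
  rw [mul_pow, PiLp.norm_sq_eq_of_L2, PiLp.norm_sq_eq_of_L2, Finset.mul_sum]
  refine Finset.sum_le_sum fun j _ => ?_
  rw [← mul_pow]
  exact pow_le_pow_left₀ (norm_nonneg _) (h j) 2

/-- Multiplication by a bounded measurable function as a bounded operator in `(L²(Ω))ⁿ`. The bound
`C` carries no sign condition, hence the constant `max C 0`. -/
def mulCLM (hm : AEMeasurable m (volume.restrict (Ω : Set (EuclideanSpace ℝ (Fin n)))))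
    (hC : ∀ᵐ x ∂(volume.restrict (Ω : Set (EuclideanSpace ℝ (Fin n)))), |m x| ≤ C) :
    L2Vec Ω →L[ℂ] L2Vec Ω :=
  LinearMap.mkContinuous
    ((mulVec Ω m).toFun ∘ₗ LinearMap.codRestrict _ LinearMap.id
      fun g => (mulVec_domain_eq_top Ω hm hC).symm ▸ Submodule.mem_top)
    (max C 0) fun g => norm_le_mul_norm_of_forall Ω (le_max_right _ _) fun j => by
      refine Lp.norm_le_mul_norm_of_ae_le_mul ?_
      filter_upwards [mulVec_apply_coeFn Ω
        ⟨g, (mulVec_domain_eq_top Ω hm hC).symm ▸ Submodule.mem_top⟩ j, hC] with x hx hCx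
      refine (congrArg norm hx).trans_le ?_
      rw [norm_mul, Complex.norm_real, Real.norm_eq_abs]
      gcongr
      exact hCx.trans (le_max_left _ _)

variable (hm : AEMeasurable m (volume.restrict (Ω : Set (EuclideanSpace ℝ (Fin n)))))
  (hC : ∀ᵐ x ∂(volume.restrict (Ω : Set (EuclideanSpace ℝ (Fin n)))), |m x| ≤ C)

theorem mulVec_apply_eq_mulCLM (g : L2Vec Ω) (hg : g ∈ (mulVec Ω m).domain) :
    mulVec Ω m ⟨g, hg⟩ = mulCLM Ω hm hC g :=
  rfl

theorem mulCLM_coeFn (g : L2Vec Ω) (j : Fin n) :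
    mulCLM Ω hm hC g j =ᵐ[volume.restrict (Ω : Set (EuclideanSpace ℝ (Fin n)))]
      fun x => (m x : ℂ) * g j x :=
  mulVec_apply_coeFn Ω ⟨g, (mulVec_domain_eq_top Ω hm hC).symm ▸ Submodule.mem_top⟩ j

theorem norm_mulCLM_apply_le (g : L2Vec Ω) : ‖mulCLM Ω hm hC g‖ ≤ max C 0 * ‖g‖ :=
  ContinuousLinearMap.le_of_opNorm_le _ (LinearMap.mkContinuous_norm_le _ (le_max_right _ _) _) g

theorem norm_sq_eq_integral (g : L2 Ω) :
    ‖g‖ ^ 2 = ∫ x in (Ω : Set (EuclideanSpace ℝ (Fin n))), ‖g x‖ ^ 2 := by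
  rw [← inner_self_eq_norm_sq (𝕜 := ℂ), L2.inner_def, ← integral_re (L2.integrable_inner _ _)]
  exact integral_congr_ae (ae_of_all _ fun x => inner_self_eq_norm_sq (𝕜 := ℂ) _)

theorem mulCLM_coercive {δ : ℝ}
    (hδ : ∀ᵐ x ∂(volume.restrict (Ω : Set (EuclideanSpace ℝ (Fin n)))), δ ≤ m x) (g : L2Vec Ω) :
    δ * ‖g‖ ^ 2 ≤ RCLike.re (inner ℂ (mulCLM Ω hm hC g) g) := by
  rw [PiLp.norm_sq_eq_of_L2, PiLp.inner_apply, map_sum, Finset.mul_sum]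
  refine Finset.sum_le_sum fun j _ => ?_
  rw [norm_sq_eq_integral, L2.inner_def, ← integral_re (L2.integrable_inner _ _),
    ← integral_const_mul]
  refine integral_mono_ae ((Lp.memLp (g j)).norm.integrable_sq.const_mul δ)
    (L2.integrable_inner _ _).re ?_
  filter_upwards [mulCLM_coeFn Ω hm hC g j, hδ] with x hx hδx
  have : inner ℂ (mulCLM Ω hm hC g j x) (g j x) = ((m x * ‖g j x‖ ^ 2 : ℝ) : ℂ) := by
    have h : inner ℂ (g j x) (g j x) = ((‖g j x‖ ^ 2 : ℝ) : ℂ) := by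
      rw [inner_self_eq_norm_sq_to_K]
      norm_cast
    rw [Complex.ofReal_mul, ← h, hx, RCLike.inner_apply, RCLike.inner_apply, map_mul,
      Complex.conj_ofReal]
    ring
  rw [this]
  change δ * ‖g j x‖ ^ 2 ≤ m x * ‖g j x‖ ^ 2
  gcongr

/-- Dominated convergence: bounded a.e. convergence of the multipliers implies strong convergence
of the multiplication operators. -/
theorem tendsto_mulCLM {mν : ℕ → EuclideanSpace ℝ (Fin n) → ℝ} {K : ℝ}
    (hmν : ∀ ν, AEMeasurable (mν ν) (volume.restrict (Ω : Set (EuclideanSpace ℝ (Fin n)))))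
    (hK : ∀ ν, ∀ᵐ x ∂(volume.restrict (Ω : Set (EuclideanSpace ℝ (Fin n)))), |mν ν x| ≤ K)
    (hlim : ∀ᵐ x ∂(volume.restrict (Ω : Set (EuclideanSpace ℝ (Fin n)))),
      Tendsto (fun ν => mν ν x) atTop (𝓝 (m x))) (g : L2Vec Ω) :
    Tendsto (fun ν => ‖(mulCLM Ω hm hC - mulCLM Ω (hmν ν) (hK ν)) g‖) atTop (𝓝 0) := by
  have hcoe : ∀ ν j, ((mulCLM Ω hm hC - mulCLM Ω (hmν ν) (hK ν)) g) j
      =ᵐ[volume.restrict (Ω : Set (EuclideanSpace ℝ (Fin n)))]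
        fun x => ((m x - mν ν x : ℝ) : ℂ) * g j x := fun ν j => by
    filter_upwards [mulCLM_coeFn Ω hm hC g j, mulCLM_coeFn Ω (hmν ν) (hK ν) g j,
      Lp.coeFn_sub (mulCLM Ω hm hC g j) (mulCLM Ω (hmν ν) (hK ν) g j)] with x h1 h2 h3
    refine h3.trans ?_
    rw [Pi.sub_apply, h1, h2, Complex.ofReal_sub, sub_mul]
  have hsq : Tendsto (fun ν => ‖(mulCLM Ω hm hC - mulCLM Ω (hmν ν) (hK ν)) g‖ ^ 2)
      atTop (𝓝 0) := by
    simp_rw [PiLp.norm_sq_eq_of_L2]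
    suffices h : ∀ j, Tendsto
        (fun ν => ‖((mulCLM Ω hm hC - mulCLM Ω (hmν ν) (hK ν)) g) j‖ ^ 2) atTop (𝓝 0) by
      simpa using tendsto_finsetSum Finset.univ fun j _ => h j
    intro j
    simp_rw [norm_sq_eq_integral]
    have h0 : ∫ _ in (Ω : Set (EuclideanSpace ℝ (Fin n))), (0 : ℝ) = 0 := integral_zero _ _
    rw [← h0]
    refine tendsto_integral_of_dominated_convergence (fun x => (C + K) ^ 2 * ‖g j x‖ ^ 2)
      (fun ν => ((Lp.aestronglyMeasurable _).norm.pow 2))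
      ((Lp.memLp (g j)).norm.integrable_sq.const_mul _) (fun ν => ?_) ?_
    · filter_upwards [hcoe ν j, hC, hK ν] with x hx hCx hKx
      rw [hx, norm_mul, Complex.norm_real, mul_pow, Real.norm_eq_abs, abs_of_nonneg (by positivity)]
      have : ‖m x - mν ν x‖ ≤ C + K := (abs_sub _ _).trans (add_le_add hCx hKx)
      gcongr
    · filter_upwards [ae_all_iff.2 fun ν => hcoe ν j, hlim] with x hx hlx
      simp_rw [hx, norm_mul, Complex.norm_real]
      have h := (((tendsto_const_nhds (x := m x)).sub hlx).norm.mul_const ‖g j x‖).pow 2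
      simpa using h
  simpa [Real.sqrt_sq] using hsq.sqrt

end Multiplication

/-! ### The diffusion operator -/

section Diffusion

variable {n : ℕ} (Ω : Opens (EuclideanSpace ℝ (Fin n)))
  {pbar : EuclideanSpace ℝ (Fin n) → ℝ} {K : ℝ}
  (hm : AEMeasurable (fun x => 1 / pbar x)
    (volume.restrict (Ω : Set (EuclideanSpace ℝ (Fin n)))))
  (hK : ∀ᵐ x ∂(volume.restrict (Ω : Set (EuclideanSpace ℝ (Fin n)))), |1 / pbar x| ≤ K)

include hm hK in
theorem mem_fluxOp_domain_iff (u : L2 Ω) :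
    u ∈ (fluxOp Ω pbar).domain ↔ u ∈ (weakGradW10 Ω).domain := by
  rw [fluxOp, mem_pcomp_domain, mulVec_domain_eq_top Ω hm hK]
  exact ⟨fun h => h.1, fun h => ⟨h, Submodule.mem_top⟩⟩

theorem fluxOp_apply (u : L2 Ω) (hu : u ∈ (fluxOp Ω pbar).domain)
    (hu' : u ∈ (weakGradW10 Ω).domain) :
    fluxOp Ω pbar ⟨u, hu⟩ = mulCLM Ω hm hK (weakGradW10 Ω ⟨u, hu'⟩) := by
  have h : weakGradW10 Ω ⟨u, hu'⟩ ∈ (mulVec Ω fun x => 1 / pbar x).domain :=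
    (mulVec_domain_eq_top Ω hm hK).symm ▸ Submodule.mem_top
  exact (pcomp_apply _ _ u hu' h hu).trans (mulVec_apply_eq_mulCLM Ω hm hK _ h)

/-- `A u = f` is equivalent to the variational equation on `W¹₀(Ω)`. -/
theorem diffusionOp_eq_iff (u f : L2 Ω) :
    (∃ hu : u ∈ (diffusionOp Ω pbar).domain, diffusionOp Ω pbar ⟨u, hu⟩ = f) ↔
      ∃ hu : u ∈ (weakGradW10 Ω).domain, ∀ v : (weakGradW10 Ω).domain,
        inner ℂ (mulCLM Ω hm hK (weakGradW10 Ω ⟨u, hu⟩)) (weakGradW10 Ω v)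
          = inner ℂ f (v : L2 Ω) := by
  rw [diffusionOp, adjoint_gradZero, pcomp_adjoint_eq_iff (dense_domain_weakGradW10 Ω)]
  constructor
  · rintro ⟨hu, h⟩
    refine ⟨(mem_fluxOp_domain_iff Ω hm hK u).1 hu, fun v => ?_⟩
    rw [← h v, fluxOp_apply Ω hm hK u hu]
  · rintro ⟨hu, h⟩
    refine ⟨(mem_fluxOp_domain_iff Ω hm hK u).2 hu, fun v => ?_⟩
    rw [← h v, fluxOp_apply Ω hm hK u _ hu]

include hm hK in
theorem diffusionOp_bijective (hP : PoincareInequality Ω) {δ : ℝ} (hδ : 0 < δ)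
    (hle : ∀ᵐ x ∂(volume.restrict (Ω : Set (EuclideanSpace ℝ (Fin n)))), δ ≤ 1 / pbar x) :
    Function.Bijective (diffusionOp Ω pbar).toFun := by
  obtain ⟨c, hc, hcle⟩ := hP.exists_le_norm
  have hcoer := mulCLM_coercive Ω hm hK hle
  constructor
  · intro u u' huu
    obtain ⟨h1, h2⟩ := (diffusionOp_eq_iff Ω hm hK u _).1 ⟨u.2, rfl⟩
    obtain ⟨h1', h2'⟩ := (diffusionOp_eq_iff Ω hm hK u' _).1 ⟨u'.2, huu.symm⟩
    exact Subtype.ext (congrArg (fun v : (weakGradW10 Ω).domain => (v : L2 Ω))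
      (weakSolution_unique hc hcle hδ hcoer h2 h2'))
  · intro f
    obtain ⟨u, hu⟩ := exists_weakSolution
      (isClosed_range_of_le_norm (isClosed_graph_weakGradW10 Ω) hc hcle) hc hcle
      (mulCLM Ω hm hK) hδ hcoer f
    obtain ⟨h1, h2⟩ := (diffusionOp_eq_iff Ω hm hK u f).2 ⟨u.2, hu⟩
    exact ⟨⟨u, h1⟩, h2⟩

/-- `A⁻¹ f` solves the variational equation, and its flux is the flux of the variational
solution. -/
theorem exists_weakSolution_solution (hA : Function.Bijective (diffusionOp Ω pbar).toFun)
    (f : L2 Ω) :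
    ∃ u : (weakGradW10 Ω).domain, (solution hA f : L2 Ω) = u ∧
      flux (solution hA f) = mulCLM Ω hm hK (weakGradW10 Ω u) ∧
      ∀ v : (weakGradW10 Ω).domain,
        inner ℂ (mulCLM Ω hm hK (weakGradW10 Ω u)) (weakGradW10 Ω v) = inner ℂ f (v : L2 Ω) := by
  obtain ⟨h1, h2⟩ := (diffusionOp_eq_iff Ω hm hK (solution hA f) f).1
    ⟨(solution hA f).2, (LinearEquiv.ofBijective (diffusionOp Ω pbar).toFun hA).apply_symm_apply f⟩
  exact ⟨⟨_, h1⟩, rfl, fluxOp_apply Ω hm hK _ _ _, h2⟩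

end Diffusion

theorem ae_one_div_bounds {α : Type*} [MeasurableSpace α] {μ : Measure α} {p : α → ℝ} {ε C : ℝ}
    (hε : 0 < ε) (hlow : ∀ᵐ x ∂μ, ε ≤ p x) (hup : ∀ᵐ x ∂μ, p x ≤ C) :
    (∀ᵐ x ∂μ, |1 / p x| ≤ 1 / ε) ∧ ∀ᵐ x ∂μ, 1 / C ≤ 1 / p x := by
  constructor
  · filter_upwards [hlow] with x hx
    rw [abs_of_pos (one_div_pos.2 (hε.trans_le hx))]
    exact one_div_le_one_div_of_le hε hx
  · filter_upwards [hlow, hup] with x hx hx'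
    exact one_div_le_one_div_of_le (hε.trans_le hx) hx'

end Diffusion

end

/-! ### Convergence of the solutions and of their fluxes -/

open Diffusion
theorem mainTheorem2 (n : ℕ) (hn : 0 < n) (Ω : Opens (EuclideanSpace ℝ (Fin n)))
    (hΩ : (Ω : Set (EuclideanSpace ℝ (Fin n))).Nonempty)
    (hPoincare : PoincareInequality Ω)
    (pbar : ℕ → EuclideanSpace ℝ (Fin n) → ℝ)
    (pbarInf : EuclideanSpace ℝ (Fin n) → ℝ)
    (hpbar : ∀ ν, pbar ν ∈ DiffusivityClass Ω)
    (hpbarInf : pbarInf ∈ DiffusivityClass Ω)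
    (hbdd : ∃ C : ℝ, ∀ ν,
      ∀ᵐ x ∂(volume.restrict (Ω : Set (EuclideanSpace ℝ (Fin n)))), |pbar ν x| ≤ C)
    (hlower : ∃ ε : ℝ, 0 < ε ∧ ∀ ν,
      ∀ᵐ x ∂(volume.restrict (Ω : Set (EuclideanSpace ℝ (Fin n)))), ε ≤ pbar ν x)
    (hconv : ∀ᵐ x ∂(volume.restrict (Ω : Set (EuclideanSpace ℝ (Fin n)))),
      Tendsto (fun ν => pbar ν x) atTop (𝓝 (pbarInf x))) :
    ∃ (hA : ∀ ν, Function.Bijective (diffusionOp Ω (pbar ν)).toFun)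
      (hAInf : Function.Bijective (diffusionOp Ω pbarInf).toFun),
      ∀ f : L2 Ω,
        Tendsto (fun ν => ‖(solution (hA ν) f : L2 Ω) - (solution hAInf f : L2 Ω)‖)
          atTop (𝓝 0) ∧
        Tendsto (fun ν => ‖flux (solution (hA ν) f) - flux (solution hAInf f)‖)
          atTop (𝓝 0) := by
  obtain ⟨C, hC⟩ := hbdd
  obtain ⟨ε, hε, hlow⟩ := hlower
  obtain ⟨hmInf, C₁, C₂, hC₁, hC₁₂, hboundInf⟩ := hpbarInf
  obtain ⟨c, hc, hcle⟩ := hPoincare.exists_le_norm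
  -- The bound `C` is not assumed positive; `max C 1` is, and it gives the coercivity constant.
  set D := max C 1
  have hD : 0 < 1 / D := one_div_pos.2 (zero_lt_one.trans_le (le_max_right _ _))
  have hm : ∀ ν, AEMeasurable (fun x => 1 / pbar ν x)
      (volume.restrict (Ω : Set (EuclideanSpace ℝ (Fin n)))) := fun ν =>
    (hpbar ν).1.const_div 1
  have hmInf' : AEMeasurable (fun x => 1 / pbarInf x)
      (volume.restrict (Ω : Set (EuclideanSpace ℝ (Fin n)))) := hmInf.const_div 1
  have hb := fun ν => ae_one_div_bounds (C := D) hε (hlow ν)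
    ((hC ν).mono fun x hx => (le_abs_self _).trans (hx.trans (le_max_left _ _)))
  have hbInf := ae_one_div_bounds hC₁ (hboundInf.mono fun x hx => hx.1)
    (hboundInf.mono fun x hx => hx.2)
  have hlim : ∀ᵐ x ∂(volume.restrict (Ω : Set (EuclideanSpace ℝ (Fin n)))),
      Tendsto (fun ν => 1 / pbar ν x) atTop (𝓝 (1 / pbarInf x)) := by
    filter_upwards [hconv, hboundInf] with x hx hx'
    exact tendsto_const_nhds.div hx (hC₁.trans_le hx'.1).ne'
  refine ⟨fun ν => diffusionOp_bijective Ω (hm ν) (hb ν).1 hPoincare hD (hb ν).2,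
    diffusionOp_bijective Ω hmInf' hbInf.1 hPoincare
      (one_div_pos.2 (hC₁.trans_le hC₁₂)) hbInf.2, fun f => ?_⟩
  choose u hu hflux hweak using fun ν => exists_weakSolution_solution Ω (hm ν) (hb ν).1
    (diffusionOp_bijective Ω (hm ν) (hb ν).1 hPoincare hD (hb ν).2) f
  obtain ⟨w, hw, hfluxw, hweakw⟩ := exists_weakSolution_solution Ω hmInf' hbInf.1
    (diffusionOp_bijective Ω hmInf' hbInf.1 hPoincare
      (one_div_pos.2 (hC₁.trans_le hC₁₂)) hbInf.2) f
  have hM := tendsto_mulCLM Ω hmInf' hbInf.1 hm (fun ν => (hb ν).1) hlim (weakGradW10 Ω w)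
  -- convergence of the gradients, by coercivity with the uniform constant `1 / D`
  have hgrad : Tendsto (fun ν => ‖weakGradW10 Ω (u ν) - weakGradW10 Ω w‖) atTop (𝓝 0) := by
    refine squeeze_zero (fun _ => norm_nonneg _) (fun ν => ?_)
      (by simpa only [mul_zero] using hM.const_mul (1 / D)⁻¹)
    exact (le_inv_mul_iff₀ hD).2 (norm_sub_le_of_weakSolution
      (mulCLM_coercive Ω (hm ν) (hb ν).1 (hb ν).2) (hweak ν) hweakw)
  constructor
  · simp_rw [hu, hw]
    refine squeeze_zero (fun _ => norm_nonneg _) (fun ν => ?_)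
      (by simpa using hgrad.const_mul c⁻¹)
    have h := hcle (u ν - w)
    rwa [LinearPMap.map_sub, ← le_inv_mul_iff₀ hc] at h
  · simp_rw [hflux, hfluxw]
    have hsum := (hgrad.const_mul (max (1 / ε) 0)).add hM
    rw [mul_zero, zero_add] at hsum
    refine squeeze_zero (fun _ => norm_nonneg _) (fun ν => ?_) hsum
    calc _ = ‖mulCLM Ω (hm ν) (hb ν).1 (weakGradW10 Ω (u ν) - weakGradW10 Ω w)
          - (mulCLM Ω hmInf' hbInf.1 - mulCLM Ω (hm ν) (hb ν).1) (weakGradW10 Ω w)‖ := by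
          rw [map_sub, _root_.sub_apply]
          congr 1
          abel
      _ ≤ _ := (norm_sub_le _ _).trans (add_le_add_left (norm_mulCLM_apply_le Ω _ _ _) _)
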